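/- Theorem (Rational Stein's Conjecture). Let $P$ be a plane polygon, that is, a compact region of the plane bounded by finitely many closed polygonal lines whose edges meet only at vertices, and whose boundary is oriented clockwise (the polygon lies on the right of each oriented edge); a single simple closed polygonal line is the basic case, but holes are allowed, and so are straight angles at the vertices. Suppose that $P$ is balanced: its oriented edges can be divided into pairs so that the two edges of each pair are parallel, equal in length and oppositely oriented. Then $P$ cannot be cut into an odd number of (nondegenerate) triangles of equal area such that all coordinates of all vertices of the triangles are rational. Here $P$ is cut into triangles if $P$ is their union and their interiors are pairwise disjoint; a vertex of one triangle may lie in the interior of a side of another triangle or of an edge of $P$. -/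

import Mathlib

open MeasureTheory Topology

/-- The Euclidean plane. -/
abbrev Plane : Type := EuclideanSpace ℝ (Fin 2)

/-- The determinant of two plane vectors: positive iff `w` points to the left of `u`. -/
def planeDet (u w : Plane) : ℝ := u 0 * w 1 - u 1 * w 0

/-- A plane polygon with clockwise oriented boundary.

The oriented edges run from `vertex i` to `vertex (next i)`; following `next` one traverses the
closed polygonal lines that bound the polygon. For a simple polygon `next` is a single cycle;
several cycles (holes, several components) are allowed too, and so are straight angles at
vertices. The orientation is the one induced by the polygon: along every edge the
polygon lies on the right-hand side of the edge (so an outer boundary is traversed clockwise). -/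
structure PlanePolygon where
  /-- the number of vertices, which is also the number of edges -/
  n : ℕ
  /-- the vertices -/
  vertex : Fin n → Plane
  /-- the index of the vertex that follows on the oriented boundary -/
  next : Equiv.Perm (Fin n)
  /-- the polygon as a set of points, boundary included -/
  region : Set Plane
  isCompact_region : IsCompact region
  vertex_ne : ∀ i, vertex i ≠ vertex (next i)
  frontier_region : frontier region = ⋃ i, segment ℝ (vertex i) (vertex (next i))
  disjoint_edges : ∀ i j, i ≠ j →
    Disjoint (openSegment ℝ (vertex i) (vertex (next i)))
      (openSegment ℝ (vertex j) (vertex (next j)))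
  region_right : ∀ i, ∀ x ∈ openSegment ℝ (vertex i) (vertex (next i)),
    ∀ᶠ y in 𝓝 x, (y ∈ region ↔ planeDet (vertex (next i) - vertex i) (y - vertex i) ≤ 0)

namespace PlanePolygon

/-- The vector of the oriented edge number `i`. -/
def edge (P : PlanePolygon) (i : Fin P.n) : Plane := P.vertex (P.next i) - P.vertex i

/-- A polygon is balanced if its edges can be divided into pairs such that the two oriented edges
of each pair are parallel, equal in length and opposite in orientation, that is, their vectors
are negatives of each other. The pairing `σ` sends every edge to its partner. -/
def IsBalanced (P : PlanePolygon) : Prop :=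
  ∃ σ : Fin P.n → Fin P.n, (∀ i, σ (σ i) = i) ∧ (∀ i, σ i ≠ i) ∧ ∀ i, P.edge (σ i) = -P.edge i

end PlanePolygon

/-- The closed solid triangle in the plane spanned by three affinely independent points. -/
def solidTriangle (t : Affine.Triangle ℝ Plane) : Set Plane := convexHull ℝ (Set.range t.points)

/-- The polygon `P` is cut into the (nondegenerate) triangles `T 0, …, T (m - 1)`: they cover
exactly `P` and do not overlap. A vertex of one triangle may lie inside a side of another one or
inside an edge of `P`. -/
def IsCutInto (P : PlanePolygon) {m : ℕ} (T : Fin m → Affine.Triangle ℝ Plane) : Prop :=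
  (⋃ i, solidTriangle (T i)) = P.region ∧
    ∀ i j, i ≠ j → Disjoint (interior (solidTriangle (T i))) (interior (solidTriangle (T j)))

/-!
The idea is to detect the 2-adic lattice spanned by a triangle with a function `G` of vectors that
is additive on every line through the origin.

Such a function has the same sum over the sides of the (clockwise) triangles of a cut as over the
edges of the polygon (`sum_sides_eq_sum_edges`): along any line, away from finitely many points,
the jump of the indicator function of a region is the signed number of boundary segments passing
through the point, and the indicator functions of the triangles add up to that of the polygon. The
edges of a balanced polygon come in pairs with opposite values of `G`, so the total is zero.

Now let all triangles have the same area, and fix one of them. In the coordinates `(x, y)` with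
respect to two of its sides, all triangles have determinant one. Put `G (x, y) = y` if `|x| < |y|`
for the 2-adic absolute value, and `G (x, y) = 0` otherwise; this is homogeneous over `ℚ`, and it
extends to a line-additive function on the real plane by means of a `ℚ`-linear retraction
`ℝ → ℚ` (the vertices of the polygon itself may be irrational). The sum of `G` over the sides of a
triangle of determinant one is always a 2-adic integer, and it is a unit exactly if the sides are
integral, that is, if the triangle spans the same `ℤ₍₂₎`-lattice as the fixed one
(`norm_sum_steepPart`). As the sum over all triangles is zero, the number of triangles spanning a
given lattice is even, and hence so is the number of all triangles (`even_of_sum_eq_zero`).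
-/

open Filter

/-! ### Determinants and triangles as intersections of half-planes -/

/-- The side function of the oriented line from `p` to `q`: negative to its right, zero on it. -/
def sideDet (p q y : Plane) : ℝ := planeDet (q - p) (y - p)

/-- The vector `v` turned by a right angle to the left. -/
noncomputable def quarterTurn (v : Plane) : Plane := !₂[-v 1, v 0]

theorem plane_ext {x y : Plane} (h0 : x 0 = y 0) (h1 : x 1 = y 1) : x = y := by
  ext i; fin_cases i <;> assumption

theorem continuous_sideDet (p q : Plane) : Continuous (sideDet p q) := by
  unfold sideDet planeDet; fun_prop

theorem sideDet_add_smul (p q x n : Plane) (t : ℝ) :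
    sideDet p q (x + t • n) = sideDet p q x + t * planeDet (q - p) n := by
  simp [sideDet, planeDet]; ring

theorem sideDet_combo {p q x y : Plane} {a b : ℝ} (h : a + b = 1) :
    sideDet p q (a • x + b • y) = a * sideDet p q x + b * sideDet p q y := by
  obtain rfl : b = 1 - a := by linarith
  simp [sideDet, planeDet]; ring

theorem sq_add_sq_pos_of_ne_zero {v : Plane} (hv : v ≠ 0) : 0 < v 0 ^ 2 + v 1 ^ 2 := by
  by_contra h
  have h0 : v 0 = 0 := by nlinarith [sq_nonneg (v 0), sq_nonneg (v 1)]
  have h1 : v 1 = 0 := by nlinarith [sq_nonneg (v 0), sq_nonneg (v 1)]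
  exact hv (plane_ext (by simpa using h0) (by simpa using h1))

theorem exists_eq_smul_of_planeDet_eq_zero {v z : Plane} (hv : v ≠ 0) (h : planeDet v z = 0) :
    ∃ a : ℝ, z = a • v := by
  have hs := sq_add_sq_pos_of_ne_zero hv
  simp only [planeDet] at h
  refine ⟨(v 0 * z 0 + v 1 * z 1) / (v 0 ^ 2 + v 1 ^ 2), plane_ext ?_ ?_⟩
  · simp only [PiLp.smul_apply, smul_eq_mul]
    field_simp
    linear_combination (-v 1) * h
  · simp only [PiLp.smul_apply, smul_eq_mul]
    field_simp
    linear_combination (v 0) * h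

theorem sum_sideDet (p : Fin 3 → Plane) (y : Plane) (k : Fin 3) :
    sideDet (p k) (p (k + 1)) y + sideDet (p (k + 1)) (p (k + 2)) y +
      sideDet (p (k + 2)) (p k) y = planeDet (p 1 - p 0) (p 2 - p 0) := by
  fin_cases k <;> simp [sideDet, planeDet] <;> ring

theorem planeDet_eq_sideDet (p : Fin 3 → Plane) (k : Fin 3) :
    sideDet (p k) (p (k + 1)) (p (k + 2)) = planeDet (p 1 - p 0) (p 2 - p 0) := by
  fin_cases k <;> simp [sideDet, planeDet] <;> ring

/-- The side functions of a triangle are its barycentric coordinates, up to the factor twice the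
oriented area. -/
theorem barycentric_identity (p : Fin 3 → Plane) (y : Plane) (k : Fin 3) :
    sideDet (p (k + 1)) (p (k + 2)) y • p k + sideDet (p (k + 2)) (p k) y • p (k + 1) +
      sideDet (p k) (p (k + 1)) y • p (k + 2) = planeDet (p 1 - p 0) (p 2 - p 0) • y := by
  apply plane_ext <;> fin_cases k <;> simp [sideDet, planeDet] <;> ring

/-- A clockwise triangle is the intersection of the closed half-planes to the right of its
sides. -/
theorem mem_triangle_iff {p : Fin 3 → Plane} (hp : planeDet (p 1 - p 0) (p 2 - p 0) < 0)
    (y : Plane) :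
    y ∈ convexHull ℝ (Set.range p) ↔ ∀ k, sideDet (p k) (p (k + 1)) y ≤ 0 := by
  constructor
  · intro hy
    have hc : Convex ℝ {y : Plane | ∀ k, sideDet (p k) (p (k + 1)) y ≤ 0} := by
      intro x hx z hz a b ha hb hab k
      rw [sideDet_combo hab]
      have := mul_nonneg ha (neg_nonneg.2 (hx k))
      have := mul_nonneg hb (neg_nonneg.2 (hz k))
      linarith
    refine convexHull_min ?_ hc hy
    rintro _ ⟨j, rfl⟩ k
    have h1 := planeDet_eq_sideDet p k
    have h2 : sideDet (p k) (p (k + 1)) (p k) = 0 := by simp [sideDet, planeDet]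
    have h3 : sideDet (p k) (p (k + 1)) (p (k + 1)) = 0 := by simp only [sideDet, planeDet]; ring
    have : ∀ j k : Fin 3, j = k ∨ j = k + 1 ∨ j = k + 2 := by decide
    rcases this j k with rfl | rfl | rfl
    · exact h2.le
    · exact h3.le
    · exact (h1.trans_lt hp).le
  · intro h
    set D := planeDet (p 1 - p 0) (p 2 - p 0)
    have hb := barycentric_identity p y 0
    have hs := sum_sideDet p y 0
    have h0 := h 0
    have h1 := h 1
    have h2 := h 2
    simp only [Fin.isValue, zero_add, show (1 + 1 : Fin 3) = 2 from rfl,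
      show (2 + 1 : Fin 3) = 0 from rfl] at hb hs h0 h1 h2
    have hy : y = (sideDet (p 1) (p 2) y / D) • p 0 + (sideDet (p 2) (p 0) y / D) • p 1 +
        (sideDet (p 0) (p 1) y / D) • p 2 := by
      have := congrArg (fun z => D⁻¹ • z) hb
      simp only [smul_add, smul_smul] at this
      rw [inv_mul_cancel₀ hp.ne, one_smul] at this
      simpa only [div_eq_inv_mul] using this.symm
    have hmem := (convex_convexHull ℝ (Set.range p)).sum_mem (t := Finset.univ)
      (w := ![sideDet (p 1) (p 2) y / D, sideDet (p 2) (p 0) y / D, sideDet (p 0) (p 1) y / D])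
      (z := p) ?_ ?_ (fun i _ => subset_convexHull ℝ _ ⟨i, rfl⟩)
    · rw [Fin.sum_univ_three] at hmem
      rw [hy]
      exact hmem
    · intro i _
      fin_cases i
      · exact div_nonneg_of_nonpos h1 hp.le
      · exact div_nonneg_of_nonpos h2 hp.le
      · exact div_nonneg_of_nonpos h0 hp.le
    · rw [Fin.sum_univ_three]
      simp only [Matrix.cons_val]
      rw [← add_div, ← add_div, div_eq_one_iff_eq hp.ne]
      linarith

theorem mem_interior_triangle {p : Fin 3 → Plane} (hp : planeDet (p 1 - p 0) (p 2 - p 0) < 0)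
    {y : Plane} (hy : ∀ k, sideDet (p k) (p (k + 1)) y < 0) :
    y ∈ interior (convexHull ℝ (Set.range p)) := by
  have ho : IsOpen {y : Plane | ∀ k, sideDet (p k) (p (k + 1)) y < 0} := by
    simp only [Set.ofPred_forall]
    exact isOpen_iInter_of_finite fun k =>
      isOpen_lt (continuous_sideDet _ _) continuous_const
  refine interior_maximal (fun z hz => ?_) ho hy
  exact (mem_triangle_iff hp z).2 fun k => (hz k).le

theorem sideDet_eq_zero_of_mem_openSegment {p q x : Plane} (h : x ∈ openSegment ℝ p q) :
    sideDet p q x = 0 := by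
  obtain ⟨a, b, ha, hb, hab, rfl⟩ := h
  rw [sideDet_combo hab]
  simp [sideDet, planeDet]; ring_nf; simp

/-- Membership in an open side of a clockwise triangle, in terms of the three side functions. -/
theorem mem_openSegment_iff {p : Fin 3 → Plane} (hp : planeDet (p 1 - p 0) (p 2 - p 0) < 0)
    {k : Fin 3} {x : Plane} (hx : sideDet (p k) (p (k + 1)) x = 0) :
    x ∈ openSegment ℝ (p k) (p (k + 1)) ↔
      sideDet (p (k + 1)) (p (k + 2)) x < 0 ∧ sideDet (p (k + 2)) (p k) x < 0 := by
  constructor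
  · rintro ⟨a, b, ha, hb, hab, rfl⟩
    have h1 : sideDet (p (k + 1)) (p (k + 2)) (p k) = planeDet (p 1 - p 0) (p 2 - p 0) := by
      rw [← planeDet_eq_sideDet p k]; simp [sideDet, planeDet]; ring
    have h2 : sideDet (p (k + 1)) (p (k + 2)) (p (k + 1)) = 0 := by simp [sideDet, planeDet]
    have h3 : sideDet (p (k + 2)) (p k) (p k) = 0 := by simp [sideDet, planeDet]; ring
    have h4 : sideDet (p (k + 2)) (p k) (p (k + 1)) = planeDet (p 1 - p 0) (p 2 - p 0) := by
      rw [← planeDet_eq_sideDet p k]; simp [sideDet, planeDet]; ring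
    rw [sideDet_combo hab, sideDet_combo hab, h1, h2, h3, h4]
    constructor <;> nlinarith
  · rintro ⟨h1, h2⟩
    have hb := barycentric_identity p x k
    have hs := sum_sideDet p x k
    rw [hx, zero_smul, add_zero] at hb
    rw [hx, zero_add] at hs
    set D := planeDet (p 1 - p 0) (p 2 - p 0)
    refine ⟨sideDet (p (k + 1)) (p (k + 2)) x / D, sideDet (p (k + 2)) (p k) x / D,
      div_pos_of_neg_of_neg h1 hp, div_pos_of_neg_of_neg h2 hp, ?_, ?_⟩
    · rw [← add_div, hs, div_self hp.ne]
    · have := congrArg (fun z => D⁻¹ • z) hb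
      simp only [smul_add, smul_smul, inv_mul_cancel₀ hp.ne, one_smul] at this
      simpa only [div_eq_inv_mul] using this

/-! ### Jumps of indicator functions across a line -/

/-- The signed multiplicity with which the oriented segment from `p` to `q`, seen as a piece of a
line with direction `v`, passes through `x`: it is `0` unless the segment is parallel to `v` and
`x` lies strictly inside it, and otherwise `1` or `-1` according to the direction of the
segment. -/
noncomputable def passing (v p q x : Plane) : ℤ :=
  open Classical in
  if x ∈ openSegment ℝ p q ∧ planeDet v (q - p) = 0 then
    (SignType.sign (planeDet (q - p) (quarterTurn v)) : ℤ) else 0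

/-- The jump of the indicator function of `S` at `x` across a line with normal `n`, at
distance `ε`. -/
noncomputable def jump (S : Set Plane) (x n : Plane) (ε : ℝ) : ℤ :=
  S.indicator 1 (x + ε • n) - S.indicator 1 (x - ε • n)

theorem sideDet_sub_smul (p q x n : Plane) (t : ℝ) :
    sideDet p q (x - t • n) = sideDet p q x - t * planeDet (q - p) n := by
  simp [sideDet, planeDet]; ring

theorem planeDet_quarterTurn_ne_zero {v e : Plane} (hv : v ≠ 0) (he : e ≠ 0)
    (h : planeDet v e = 0) : planeDet e (quarterTurn v) ≠ 0 := by
  obtain ⟨a, rfl⟩ := exists_eq_smul_of_planeDet_eq_zero hv h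
  have ha : a ≠ 0 := by rintro rfl; simp at he
  have := sq_add_sq_pos_of_ne_zero hv
  have h2 : planeDet (a • v) (quarterTurn v) = a * (v 0 ^ 2 + v 1 ^ 2) := by
    simp [planeDet, quarterTurn]; ring
  rw [h2]
  positivity

theorem planeDet_eq_zero_trans {v e f : Plane} (hv : v ≠ 0) (he : planeDet v e = 0)
    (hf : planeDet v f = 0) : planeDet e f = 0 := by
  obtain ⟨a, rfl⟩ := exists_eq_smul_of_planeDet_eq_zero hv he
  obtain ⟨b, rfl⟩ := exists_eq_smul_of_planeDet_eq_zero hv hf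
  simp [planeDet]; ring

theorem eventually_mem_add_smul {x n : Plane} {U : Set Plane} (hU : U ∈ 𝓝 x) :
    ∀ᶠ ε : ℝ in 𝓝[>] 0, x + ε • n ∈ U ∧ x - ε • n ∈ U := by
  refine Filter.Eventually.filter_mono nhdsWithin_le_nhds ?_
  have h1 : Tendsto (fun ε : ℝ => x + ε • n) (𝓝 0) (𝓝 x) := by
    have : Continuous (fun ε : ℝ => x + ε • n) := by fun_prop
    simpa using this.tendsto 0
  have h2 : Tendsto (fun ε : ℝ => x - ε • n) (𝓝 0) (𝓝 x) := by
    have : Continuous (fun ε : ℝ => x - ε • n) := by fun_prop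
    simpa using this.tendsto 0
  exact (h1.eventually hU).and (h2.eventually hU)

theorem eventually_sideDet_ne_zero {p q v x : Plane} (hv : v ≠ 0) (hpq : p ≠ q)
    (hx : sideDet p q x = 0 → planeDet v (q - p) = 0) :
    ∀ᶠ ε : ℝ in 𝓝[>] 0, sideDet p q (x + ε • quarterTurn v) ≠ 0 ∧
      sideDet p q (x - ε • quarterTurn v) ≠ 0 := by
  by_cases h : sideDet p q x = 0
  · have hd := planeDet_quarterTurn_ne_zero hv (sub_ne_zero.2 hpq.symm) (hx h)
    filter_upwards [self_mem_nhdsWithin] with ε hε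
    have hε : 0 < ε := hε
    rw [sideDet_add_smul, sideDet_sub_smul, h]
    constructor
    · rw [zero_add]; positivity
    · rw [zero_sub, neg_ne_zero]; positivity
  · exact eventually_mem_add_smul ((continuous_sideDet p q).continuousAt.eventually_ne h)

/-- If near `x` the set `S` is the closed right half-plane of the oriented line from `p` to `q`,
which passes through `x`, then the jump of its indicator function is minus the direction of the
line. -/
theorem jump_eq_of_halfPlane {S : Set Plane} {p q v x : Plane} (hv : v ≠ 0) (hpq : p ≠ q)
    (hx : sideDet p q x = 0) (hd : planeDet v (q - p) = 0)
    (hS : ∀ᶠ y in 𝓝 x, (y ∈ S ↔ sideDet p q y ≤ 0)) :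
    ∀ᶠ ε : ℝ in 𝓝[>] 0, jump S x (quarterTurn v) ε =
      -(SignType.sign (planeDet (q - p) (quarterTurn v)) : ℤ) := by
  have hd := planeDet_quarterTurn_ne_zero hv (sub_ne_zero.2 hpq.symm) hd
  filter_upwards [self_mem_nhdsWithin, eventually_mem_add_smul hS] with ε hε hm
  have hε : 0 < ε := hε
  have h1 : _ ↔ _ := hm.1
  have h2 : _ ↔ _ := hm.2
  rw [sideDet_add_smul, hx, zero_add] at h1
  rw [sideDet_sub_smul, hx, zero_sub] at h2
  rcases lt_or_gt_of_ne hd with h | h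
  · have hm1 : x + ε • quarterTurn v ∈ S := h1.2 (by nlinarith)
    have hm2 : x - ε • quarterTurn v ∉ S := fun hh => by have := h2.1 hh; nlinarith
    rw [jump, Set.indicator_of_mem hm1, Set.indicator_of_notMem hm2, sign_neg h]
    simp
  · have hm1 : x + ε • quarterTurn v ∉ S := fun hh => by have := h1.1 hh; nlinarith
    have hm2 : x - ε • quarterTurn v ∈ S := h2.2 (by nlinarith)
    rw [jump, Set.indicator_of_mem hm2, Set.indicator_of_notMem hm1, sign_pos h]
    simp

theorem jump_eq_zero_of_mem {S : Set Plane} {x n : Plane} (hS : S ∈ 𝓝 x) :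
    ∀ᶠ ε : ℝ in 𝓝[>] 0, jump S x n ε = 0 := by
  filter_upwards [eventually_mem_add_smul (n := n) hS] with ε hε
  simp [jump, hε.1, hε.2]

theorem jump_eq_zero_of_compl_mem {S : Set Plane} {x n : Plane} (hS : Sᶜ ∈ 𝓝 x) :
    ∀ᶠ ε : ℝ in 𝓝[>] 0, jump S x n ε = 0 := by
  filter_upwards [eventually_mem_add_smul (n := n) hS] with ε hε
  have h1 : x + ε • n ∉ S := hε.1
  have h2 : x - ε • n ∉ S := hε.2
  simp [jump, h1, h2]

theorem triangle_vertex_ne {p : Fin 3 → Plane} (hp : planeDet (p 1 - p 0) (p 2 - p 0) < 0)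
    (k : Fin 3) : p k ≠ p (k + 1) := by
  intro h
  have := planeDet_eq_sideDet p k
  rw [h] at this
  simp only [sideDet, sub_self, planeDet, PiLp.zero_apply, zero_mul] at this
  simp only [planeDet] at hp
  linarith

theorem triangle_sides_not_parallel {p : Fin 3 → Plane}
    (hp : planeDet (p 1 - p 0) (p 2 - p 0) < 0) {j k : Fin 3} (hj : j ≠ k) :
    planeDet (p (k + 1) - p k) (p (j + 1) - p j) ≠ 0 := by
  intro h
  refine hp.ne ?_
  fin_cases k <;> fin_cases j <;> simp [planeDet] at hj h ⊢ <;>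
    first | linear_combination h | linear_combination -h

theorem passing_eq_zero_of_notMem {v p q x : Plane} (h : x ∉ openSegment ℝ p q) :
    passing v p q x = 0 :=
  if_neg fun hh => h hh.1

theorem passing_eq_zero_of_sideDet_ne {v p q x : Plane} (h : sideDet p q x ≠ 0) :
    passing v p q x = 0 :=
  if_neg fun hh => h (sideDet_eq_zero_of_mem_openSegment hh.1)

theorem sum_fin_three_cyclic {M : Type*} [AddCommMonoid M] (f : Fin 3 → M) (k : Fin 3) :
    ∑ i, f i = f k + f (k + 1) + f (k + 2) := by
  rw [← Equiv.sum_comp (Equiv.addLeft k), Fin.sum_univ_three]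
  simp

/-- The jump of the indicator function of a clockwise triangle across a line, at a point that lies
on no side line transversal to the line. -/
theorem jump_triangle {p : Fin 3 → Plane} (hp : planeDet (p 1 - p 0) (p 2 - p 0) < 0)
    {v x : Plane} (hv : v ≠ 0)
    (hx : ∀ k, sideDet (p k) (p (k + 1)) x = 0 → planeDet v (p (k + 1) - p k) = 0) :
    ∀ᶠ ε : ℝ in 𝓝[>] 0, jump (convexHull ℝ (Set.range p)) x (quarterTurn v) ε =
      -∑ k, passing v (p k) (p (k + 1)) x := by
  have hc : ∀ k : Fin 3, k + 1 + 1 = k + 2 ∧ k + 2 + 1 = k := by decide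
  by_cases hall : ∀ k, sideDet (p k) (p (k + 1)) x ≠ 0
  · rw [Finset.sum_eq_zero fun k _ => passing_eq_zero_of_sideDet_ne (hall k), neg_zero]
    by_cases hneg : ∀ k, sideDet (p k) (p (k + 1)) x < 0
    · exact jump_eq_zero_of_mem (mem_interior_iff_mem_nhds.1 (mem_interior_triangle hp hneg))
    · push Not at hneg
      obtain ⟨k, hk⟩ := hneg
      have hk : 0 < sideDet (p k) (p (k + 1)) x := lt_of_le_of_ne hk (hall k).symm
      apply jump_eq_zero_of_compl_mem
      filter_upwards [(continuous_sideDet _ _).continuousAt.eventually_const_lt hk] with y hy hm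
      exact hy.not_ge ((mem_triangle_iff hp y).1 hm k)
  · push Not at hall
    obtain ⟨k, hk⟩ := hall
    have hkv := hx k hk
    have hpar : ∀ j, j ≠ k → sideDet (p j) (p (j + 1)) x ≠ 0 := fun j hj h0 =>
      triangle_sides_not_parallel hp hj (planeDet_eq_zero_trans hv hkv (hx j h0))
    have hne : ∀ k : Fin 3, k + 1 ≠ k ∧ k + 2 ≠ k := by decide
    have h1 := hpar (k + 1) (hne k).1
    have h2 := hpar (k + 2) (hne k).2
    rw [sum_fin_three_cyclic _ k, passing_eq_zero_of_sideDet_ne h1,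
      passing_eq_zero_of_sideDet_ne h2, add_zero, add_zero]
    rw [(hc k).1] at h1
    rw [(hc k).2] at h2
    by_cases hneg : sideDet (p (k + 1)) (p (k + 2)) x < 0 ∧ sideDet (p (k + 2)) (p k) x < 0
    · rw [passing, if_pos ⟨(mem_openSegment_iff hp hk).2 hneg, hkv⟩]
      refine jump_eq_of_halfPlane hv (triangle_vertex_ne hp k) hk hkv ?_
      filter_upwards [(continuous_sideDet _ _).continuousAt.eventually_lt_const hneg.1,
        (continuous_sideDet _ _).continuousAt.eventually_lt_const hneg.2] with y hy1 hy2
      rw [mem_triangle_iff hp]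
      refine ⟨fun h => h k, fun h j => ?_⟩
      have : ∀ j k : Fin 3, j = k ∨ j = k + 1 ∨ j = k + 2 := by decide
      rcases this j k with rfl | rfl | rfl
      · exact h
      · rw [(hc k).1]; exact hy1.le
      · rw [(hc k).2]; exact hy2.le
    · rw [passing, if_neg fun h => hneg ((mem_openSegment_iff hp hk).1 h.1), neg_zero]
      have : 0 < sideDet (p (k + 1)) (p (k + 1 + 1)) x ∨
          0 < sideDet (p (k + 2)) (p (k + 2 + 1)) x := by
        rw [(hc k).1, (hc k).2]
        by_contra hcon
        push Not at hcon
        exact hneg ⟨lt_of_le_of_ne hcon.1 h1, lt_of_le_of_ne hcon.2 h2⟩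
      obtain ⟨j, hj⟩ : ∃ j, 0 < sideDet (p j) (p (j + 1)) x := by
        rcases this with h | h <;> exact ⟨_, h⟩
      apply jump_eq_zero_of_compl_mem
      filter_upwards [(continuous_sideDet _ _).continuousAt.eventually_const_lt hj] with y hy hm
      exact hy.not_ge ((mem_triangle_iff hp y).1 hm j)

/-- The jump of the indicator function of a polygon across a line, at a point that is no vertex and
lies on no edge transversal to the line. -/
theorem jump_region (P : PlanePolygon) {v x : Plane} (hv : v ≠ 0) (hvert : ∀ i, x ≠ P.vertex i)
    (hx : ∀ i, sideDet (P.vertex i) (P.vertex (P.next i)) x = 0 → planeDet v (P.edge i) = 0) :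
    ∀ᶠ ε : ℝ in 𝓝[>] 0, jump P.region x (quarterTurn v) ε =
      -∑ i, passing v (P.vertex i) (P.vertex (P.next i)) x := by
  by_cases h : ∃ i, x ∈ openSegment ℝ (P.vertex i) (P.vertex (P.next i))
  · obtain ⟨i, hi⟩ := h
    have h0 := sideDet_eq_zero_of_mem_openSegment hi
    rw [Finset.sum_eq_single i, passing, if_pos ⟨hi, hx i h0⟩]
    · exact jump_eq_of_halfPlane hv (P.vertex_ne i) h0 (hx i h0) (P.region_right i x hi)
    · intro j _ hj
      exact passing_eq_zero_of_notMem fun hh =>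
        Set.disjoint_left.1 (P.disjoint_edges j i hj) hh hi
    · simp
  · push Not at h
    rw [Finset.sum_eq_zero fun i _ => passing_eq_zero_of_notMem (h i), neg_zero]
    have hf : x ∉ frontier P.region := by
      rw [P.frontier_region, Set.mem_iUnion]
      rintro ⟨i, hi⟩
      rw [← insert_endpoints_openSegment] at hi
      rcases hi with hi | hi | hi
      · exact hvert _ hi
      · exact hvert _ hi
      · exact h i hi
    by_cases hin : x ∈ interior P.region
    · exact jump_eq_zero_of_mem (mem_interior_iff_mem_nhds.1 hin)
    · have : x ∉ closure P.region := fun hc => hf ⟨hc, hin⟩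
      refine jump_eq_zero_of_compl_mem ?_
      rw [← mem_interior_iff_mem_nhds, interior_compl]
      exact this

/-- Off the lines that carry the sides, a cut is an exact decomposition of indicator
functions. -/
theorem sum_indicator_of_cut {m : ℕ} {p : Fin m → Fin 3 → Plane} {R : Set Plane}
    (hp : ∀ j, planeDet (p j 1 - p j 0) (p j 2 - p j 0) < 0)
    (hU : (⋃ j, convexHull ℝ (Set.range (p j))) = R)
    (hI : ∀ i j, i ≠ j → Disjoint (interior (convexHull ℝ (Set.range (p i))))
      (interior (convexHull ℝ (Set.range (p j)))))
    {y : Plane} (hy : ∀ j k, sideDet (p j k) (p j (k + 1)) y ≠ 0) :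
    ∑ j, (convexHull ℝ (Set.range (p j))).indicator (1 : Plane → ℤ) y = R.indicator 1 y := by
  have hint : ∀ j, y ∈ convexHull ℝ (Set.range (p j)) →
      y ∈ interior (convexHull ℝ (Set.range (p j))) := fun j hj =>
    mem_interior_triangle (hp j) fun k =>
      lt_of_le_of_ne ((mem_triangle_iff (hp j) y).1 hj k) (hy j k)
  by_cases h : ∃ j, y ∈ convexHull ℝ (Set.range (p j))
  · obtain ⟨j, hj⟩ := h
    rw [Finset.sum_eq_single j]
    · have : y ∈ R := hU ▸ Set.mem_iUnion.2 ⟨j, hj⟩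
      simp [hj, this]
    · intro i _ hij
      refine Set.indicator_of_notMem (fun hi => ?_) _
      exact Set.disjoint_left.1 (hI i j hij) (hint i hi) (hint j hj)
    · simp
  · have hR : y ∉ R := by rw [← hU, Set.mem_iUnion]; exact h
    push Not at h
    rw [Finset.sum_eq_zero fun i _ => Set.indicator_of_notMem (h i) _]
    simp [hR]

/-! ### Vanishing chains -/

/-- If the step functions of finitely many weighted oriented intervals `(a i, b i)` of the real
line add up to zero at all but finitely many points, then the boundary of this chain is zero. -/
theorem sum_smul_sub_eq_zero {ι A : Type*} [AddCommGroup A] (S : Finset ι) (s : ι → ℤ)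
    (a b : ι → ℝ)
    (h : ∀ᶠ t in cofinite,
      ∑ i ∈ S, s i * ((if a i < t then 1 else 0) - (if b i < t then 1 else 0)) = 0)
    (g : ℝ → A) : ∑ i ∈ S, s i • (g (b i) - g (a i)) = 0 := by
  have hleft : ∀ c x : ℝ, ∀ᶠ t in 𝓝[<] c, (x < t ↔ x < c) := by
    intro c x
    rcases lt_or_ge x c with hx | hx
    · filter_upwards [eventually_nhdsWithin_of_eventually_nhds (lt_mem_nhds hx)] with t ht
      exact iff_of_true ht hx
    · filter_upwards [self_mem_nhdsWithin] with t (ht : t < c)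
      exact iff_of_false (ht.trans_le hx).not_gt hx.not_gt
  have hright : ∀ c x : ℝ, ∀ᶠ t in 𝓝[>] c, (x < t ↔ x ≤ c) := by
    intro c x
    rcases le_or_gt x c with hx | hx
    · filter_upwards [self_mem_nhdsWithin] with t (ht : c < t)
      exact iff_of_true (hx.trans_lt ht) hx
    · filter_upwards [eventually_nhdsWithin_of_eventually_nhds (gt_mem_nhds hx)] with t ht
      exact iff_of_false ht.not_gt hx.not_ge
  -- The generic identity passes to the one-sided limits at `c`; their difference is the
  -- coefficient of `c` in the boundary.
  have hlt : ∀ c : ℝ,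
      ∑ i ∈ S, s i * ((if a i < c then 1 else 0) - (if b i < c then 1 else 0)) = 0 := by
    intro c
    have h' := (h.filter_mono (nhdsNE_le_cofinite c)).filter_mono (nhdsLT_le_nhdsNE c)
    have e1 := (Finset.eventually_all S).2 fun i _ => hleft c (a i)
    have e2 := (Finset.eventually_all S).2 fun i _ => hleft c (b i)
    obtain ⟨t, ht, h1, h2⟩ := (h'.and (e1.and e2)).exists
    refine Eq.trans ?_ ht
    exact Finset.sum_congr rfl fun i hi => by simp only [h1 i hi, h2 i hi]
  have hle : ∀ c : ℝ,
      ∑ i ∈ S, s i * ((if a i ≤ c then 1 else 0) - (if b i ≤ c then 1 else 0)) = 0 := by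
    intro c
    have h' := (h.filter_mono (nhdsNE_le_cofinite c)).filter_mono (nhdsGT_le_nhdsNE c)
    have e1 := (Finset.eventually_all S).2 fun i _ => hright c (a i)
    have e2 := (Finset.eventually_all S).2 fun i _ => hright c (b i)
    obtain ⟨t, ht, h1, h2⟩ := (h'.and (e1.and e2)).exists
    refine Eq.trans ?_ ht
    exact Finset.sum_congr rfl fun i hi => by simp only [h1 i hi, h2 i hi]
  have heq : ∀ c : ℝ,
      ∑ i ∈ S, s i * ((if b i = c then 1 else 0) - (if a i = c then 1 else 0)) = 0 := by
    intro c
    have ind : ∀ x : ℝ, (if x = c then (1 : ℤ) else 0) =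
        (if x ≤ c then 1 else 0) - (if x < c then 1 else 0) := by
      intro x
      rcases lt_trichotomy x c with hx | hx | hx
      · simp [hx, hx.ne, hx.le]
      · simp [hx]
      · simp [hx.ne', hx.not_ge, hx.not_gt]
    have h' := congrArg₂ (· - ·) (hlt c) (hle c)
    simp only [sub_self, ← Finset.sum_sub_distrib] at h'
    refine Eq.trans (Finset.sum_congr rfl fun i _ => ?_) h'
    rw [ind, ind]; ring
  classical
  set C := S.image a ∪ S.image b
  have hg : ∀ x ∈ C, g x = ∑ c ∈ C, (if x = c then (1 : ℤ) else 0) • g c := by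
    intro x hx
    simp [ite_smul, hx]
  calc ∑ i ∈ S, s i • (g (b i) - g (a i))
      = ∑ i ∈ S, ∑ c ∈ C,
          (s i * ((if b i = c then 1 else 0) - (if a i = c then 1 else 0))) • g c := by
        refine Finset.sum_congr rfl fun i hi => ?_
        rw [hg (b i) (Finset.mem_union_right _ (Finset.mem_image_of_mem _ hi)),
          hg (a i) (Finset.mem_union_left _ (Finset.mem_image_of_mem _ hi)),
          ← Finset.sum_sub_distrib, Finset.smul_sum]
        exact Finset.sum_congr rfl fun c _ => by rw [← sub_smul, smul_smul]
    _ = 0 := by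
        rw [Finset.sum_comm]
        refine Finset.sum_eq_zero fun c _ => ?_
        rw [← Finset.sum_smul, heq c, zero_smul]

theorem mem_openSegment_line {x₀ v : Plane} (hv : v ≠ 0) {a b t : ℝ} :
    x₀ + t • v ∈ openSegment ℝ (x₀ + a • v) (x₀ + b • v) ↔ t ∈ openSegment ℝ a b := by
  constructor
  · rintro ⟨c, d, hc, hd, hcd, he⟩
    refine ⟨c, d, hc, hd, hcd, ?_⟩
    obtain rfl : c = 1 - d := by linarith
    have h2 : ((1 - d) * a + d * b) • v = t • v := by
      have h3 : x₀ + ((1 - d) * a + d * b) • v = x₀ + t • v := by rw [← he]; module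
      exact add_left_cancel h3
    simpa using smul_left_injective ℝ hv h2
  · rintro ⟨c, d, hc, hd, hcd, rfl⟩
    refine ⟨c, d, hc, hd, hcd, ?_⟩
    obtain rfl : c = 1 - d := by linarith
    simp only [smul_eq_mul]
    module

theorem passing_line {x₀ v : Plane} (hv : v ≠ 0) {a b t : ℝ} (hta : t ≠ a) (htb : t ≠ b) :
    passing v (x₀ + a • v) (x₀ + b • v) (x₀ + t • v) =
      (if a < t then 1 else 0) - (if b < t then 1 else 0) := by
  have he : x₀ + b • v - (x₀ + a • v) = (b - a) • v := by module
  have hs := sq_add_sq_pos_of_ne_zero hv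
  have hq : planeDet ((b - a) • v) (quarterTurn v) = (b - a) * (v 0 ^ 2 + v 1 ^ 2) := by
    simp [planeDet, quarterTurn]; ring
  have hz : planeDet v ((b - a) • v) = 0 := by simp [planeDet]; ring
  rw [passing, mem_openSegment_line hv, he, hz, hq, sign_mul, sign_pos hs, mul_one]
  rcases lt_trichotomy a b with hab | rfl | hab
  · rw [openSegment_eq_Ioo hab, sign_pos (sub_pos.2 hab)]
    rcases lt_or_gt_of_ne hta with h1 | h1 <;> rcases lt_or_gt_of_ne htb with h2 | h2
    · simp [h1.not_gt, h2.not_gt]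
    · linarith
    · simp [h1, h2, h2.not_gt]
    · simp [h1, h2, h2.not_gt]
  · simp
  · rw [openSegment_symm, openSegment_eq_Ioo hab, sign_neg (sub_neg.2 hab)]
    rcases lt_or_gt_of_ne hta with h1 | h1 <;> rcases lt_or_gt_of_ne htb with h2 | h2
    · simp [h1.not_gt, h2.not_gt]
    · simp [h1, h2, h1.not_gt]
    · linarith
    · simp [h1, h2, h1.not_gt]

/-- The line through two distinct points. -/
def lineThrough (p q : Plane) : Set Plane := {z | sideDet p q z = 0}

theorem lineThrough_line {x₀ v : Plane} {a b : ℝ} (hab : a ≠ b) :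
    lineThrough (x₀ + a • v) (x₀ + b • v) = {z | planeDet v (z - x₀) = 0} := by
  ext z
  have h : sideDet (x₀ + a • v) (x₀ + b • v) z = (b - a) * planeDet v (z - x₀) := by
    simp [sideDet, planeDet]; ring
  have hab : b - a ≠ 0 := sub_ne_zero.2 hab.symm
  simp [lineThrough, h, hab]

theorem exists_eq_add_smul_of_mem_lineThrough {p q z : Plane} (hpq : p ≠ q)
    (hz : z ∈ lineThrough p q) : ∃ a : ℝ, z = p + a • (q - p) := by
  obtain ⟨a, ha⟩ := exists_eq_smul_of_planeDet_eq_zero (sub_ne_zero.2 hpq.symm) hz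
  exact ⟨a, by rw [← ha]; abel⟩

/-- If finitely many weighted oriented segments cancel along every line, up to finitely many
points, then so do the values on them of any function that is additive on each line through the
origin. -/
theorem sum_smul_eq_zero_of_passing {ι A : Type*} [Fintype ι] [AddCommGroup A] (s : ι → ℤ)
    (p q : ι → Plane) (hpq : ∀ i, p i ≠ q i)
    (h : ∀ x₀ v : Plane, v ≠ 0 →
      ∀ᶠ t : ℝ in cofinite, ∑ i, s i * passing v (p i) (q i) (x₀ + t • v) = 0)
    (G : Plane → A) (hG : ∀ v : Plane, ∀ t u : ℝ, G ((t + u) • v) = G (t • v) + G (u • v)) :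
    ∑ i, s i • G (q i - p i) = 0 := by
  classical
  rw [← Finset.sum_fiberwise_of_maps_to (t := Finset.univ.image fun i => lineThrough (p i) (q i))
    (g := fun i => lineThrough (p i) (q i)) (fun i hi => Finset.mem_image_of_mem _ hi)]
  refine Finset.sum_eq_zero fun L hL => ?_
  obtain ⟨i₀, _, rfl⟩ := Finset.mem_image.1 hL
  set x₀ := p i₀
  set v := q i₀ - p i₀
  have hv : v ≠ 0 := sub_ne_zero.2 (hpq i₀).symm
  have hself : lineThrough x₀ (q i₀) = {z | planeDet v (z - x₀) = 0} := rfl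
  set S := Finset.univ.filter fun i => lineThrough (p i) (q i) = lineThrough x₀ (q i₀)
  have hpar : ∀ i, ∃ a b : ℝ, i ∈ S → p i = x₀ + a • v ∧ q i = x₀ + b • v := by
    intro i
    by_cases hi : i ∈ S
    · have hL := (Finset.mem_filter.1 hi).2
      have hp : p i ∈ lineThrough (p i) (q i) := by simp [lineThrough, sideDet, planeDet]
      have hq : q i ∈ lineThrough (p i) (q i) := by
        simp only [lineThrough, sideDet, planeDet, Set.mem_ofPred_eq]; ring
      rw [hL] at hp hq
      obtain ⟨a, ha⟩ := exists_eq_add_smul_of_mem_lineThrough (hpq i₀) hp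
      obtain ⟨b, hb⟩ := exists_eq_add_smul_of_mem_lineThrough (hpq i₀) hq
      exact ⟨a, b, fun _ => ⟨ha, hb⟩⟩
    · exact ⟨0, 0, fun h => absurd h hi⟩
  choose a b hab using hpar
  -- A segment that runs along the line of `i₀` somewhere spans that same line.
  have hout : ∀ i ∉ S, ∀ t : ℝ, passing v (p i) (q i) (x₀ + t • v) = 0 := by
    intro i hi t
    refine if_neg fun ⟨hm, hd⟩ => hi (Finset.mem_filter.2 ⟨Finset.mem_univ _, ?_⟩)
    obtain ⟨c, hc⟩ := exists_eq_smul_of_planeDet_eq_zero hv hd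
    obtain ⟨d, e, hd, he, hde, hx⟩ := hm
    have hpi : p i = x₀ + (t - e * c) • v := by
      have hqi : q i = p i + c • v := by rw [← hc]; abel
      rw [hqi] at hx
      obtain rfl : d = 1 - e := by linarith
      have h2 : p i + (e * c) • v = x₀ + t • v := by rw [← hx]; module
      rw [sub_smul, ← add_sub_assoc, ← h2, add_sub_cancel_right]
    have hqi : q i = x₀ + (t - e * c + c) • v := by
      rw [add_smul, ← add_assoc, ← hpi, ← hc]; abel
    have hne : t - e * c ≠ t - e * c + c := by
      intro h0
      apply hpq i
      rw [hqi, ← h0, ← hpi]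
    rw [hself, hpi, hqi, lineThrough_line hne]
  have key := sum_smul_sub_eq_zero S s a b ?_ fun t => G (t • v)
  · rw [← key]
    refine Finset.sum_congr rfl fun i hi => ?_
    obtain ⟨h1, h2⟩ := hab i hi
    have h3 : q i - p i = (b i - a i) • v := by rw [h1, h2]; module
    have h4 := hG v (b i - a i) (a i)
    rw [sub_add_cancel] at h4
    rw [h3, h4, add_sub_cancel_right]
  · have hfin : ∀ᶠ t : ℝ in cofinite, ∀ i, t ≠ a i ∧ t ≠ b i :=
      eventually_all.2 fun i => (eventually_cofinite_ne _).and (eventually_cofinite_ne _)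
    filter_upwards [h x₀ v hv, hfin] with t ht hne
    rw [← Finset.sum_subset (Finset.subset_univ S)
      fun i _ hi => by rw [hout i hi t, mul_zero]] at ht
    refine Eq.trans (Finset.sum_congr rfl fun i hi => ?_) ht
    obtain ⟨h1, h2⟩ := hab i hi
    rw [h1, h2, passing_line hv (hne i).1 (hne i).2]

/-- A general point of a line lies on no other line. -/
theorem eventually_sideDet_line (p q x₀ v : Plane) :
    ∀ᶠ t : ℝ in cofinite, sideDet p q (x₀ + t • v) = 0 → planeDet v (q - p) = 0 := by
  by_cases h : planeDet v (q - p) = 0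
  · exact Eventually.of_forall fun _ _ => h
  · have h' : planeDet (q - p) v ≠ 0 := by
      intro h0; apply h; simp only [planeDet] at h0 ⊢; linear_combination -h0
    filter_upwards [eventually_cofinite_ne (-sideDet p q x₀ / planeDet (q - p) v)] with t ht h0
    refine absurd ?_ ht
    rw [sideDet_add_smul] at h0
    field_simp
    linarith

theorem eventually_ne_line {v : Plane} (hv : v ≠ 0) (x₀ y : Plane) :
    ∀ᶠ t : ℝ in cofinite, x₀ + t • v ≠ y := by
  have : Set.Subsingleton {t : ℝ | x₀ + t • v = y} := by
    intro t ht u hu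
    have h1 : x₀ + t • v = x₀ + u • v := Eq.trans ht (Eq.symm hu)
    exact smul_left_injective ℝ hv (add_left_cancel h1)
  exact this.finite.compl_mem_cofinite

/-- If a polygon is cut into clockwise triangles, then every function that is additive on each
line through the origin has the same sum over the sides of the triangles as over the edges of
the polygon. -/
theorem sum_sides_eq_sum_edges (P : PlanePolygon) {m : ℕ} {p : Fin m → Fin 3 → Plane}
    (hp : ∀ j, planeDet (p j 1 - p j 0) (p j 2 - p j 0) < 0)
    (hU : (⋃ j, convexHull ℝ (Set.range (p j))) = P.region)
    (hI : ∀ i j, i ≠ j → Disjoint (interior (convexHull ℝ (Set.range (p i))))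
      (interior (convexHull ℝ (Set.range (p j)))))
    {A : Type*} [AddCommGroup A] (G : Plane → A)
    (hG : ∀ v : Plane, ∀ t u : ℝ, G ((t + u) • v) = G (t • v) + G (u • v)) :
    ∑ j, ∑ k, G (p j (k + 1) - p j k) = ∑ i, G (P.edge i) := by
  have key := sum_smul_eq_zero_of_passing (ι := (Fin m × Fin 3) ⊕ Fin P.n)
    (Sum.elim (fun _ => 1) (fun _ => -1))
    (Sum.elim (fun jk => p jk.1 jk.2) P.vertex)
    (Sum.elim (fun jk => p jk.1 (jk.2 + 1)) fun i => P.vertex (P.next i)) ?_ ?_ G hG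
  · simp only [Fintype.sum_sum_type, Sum.elim_inl, Sum.elim_inr, one_smul, neg_smul,
      Finset.sum_neg_distrib, Fintype.sum_prod_type] at key
    exact sub_eq_zero.1 (by rw [sub_eq_add_neg]; exact key)
  · rintro (⟨j, k⟩ | i)
    · exact triangle_vertex_ne (hp j) k
    · exact P.vertex_ne i
  · intro x₀ v hv
    have e1 : ∀ᶠ t : ℝ in cofinite, ∀ j k, sideDet (p j k) (p j (k + 1)) (x₀ + t • v) = 0 →
        planeDet v (p j (k + 1) - p j k) = 0 :=
      eventually_all.2 fun j => eventually_all.2 fun k => eventually_sideDet_line _ _ _ _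
    have e2 : ∀ᶠ t : ℝ in cofinite, ∀ i,
        sideDet (P.vertex i) (P.vertex (P.next i)) (x₀ + t • v) = 0 →
          planeDet v (P.edge i) = 0 :=
      eventually_all.2 fun i => eventually_sideDet_line _ _ _ _
    have e3 : ∀ᶠ t : ℝ in cofinite, ∀ i, x₀ + t • v ≠ P.vertex i :=
      eventually_all.2 fun i => eventually_ne_line hv _ _
    filter_upwards [e1, e2, e3] with t h1 h2 h3
    have f1 := eventually_all.2 fun j => jump_triangle (hp j) hv (h1 j)
    have f2 := jump_region P hv h3 h2
    have f3 := eventually_all.2 fun j => eventually_all.2 fun k =>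
      eventually_sideDet_ne_zero hv (triangle_vertex_ne (hp j) k) (h1 j k)
    -- Both points at distance `ε` from the line avoid all sides, so that the indicators add up.
    obtain ⟨ε, g1, g2, g3⟩ := (f1.and (f2.and f3)).exists
    have g4 := sum_indicator_of_cut hp hU hI fun j k => (g3 j k).1
    have g5 := sum_indicator_of_cut hp hU hI fun j k => (g3 j k).2
    rw [jump, ← g4, ← g5, ← Finset.sum_sub_distrib] at g2
    have g6 := Finset.sum_congr rfl fun j (_ : j ∈ Finset.univ) => g1 j
    simp only [jump] at g6
    rw [g6, Finset.sum_neg_distrib, neg_inj] at g2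
    simp only [Fintype.sum_sum_type, Sum.elim_inl, Sum.elim_inr, one_mul, neg_mul,
      Finset.sum_neg_distrib, Fintype.sum_prod_type]
    rw [g2, add_neg_cancel]

/-! ### Arithmetic of triangles over the 2-adic numbers -/

/-- The determinant of two rational vectors. -/
def cross (z w : ℚ × ℚ) : ℚ := z.1 * w.2 - z.2 * w.1

/-- The second coordinate of a vector whose line is 2-adically steep, and `0` for all other
vectors. -/
noncomputable def steepPart (a b : ℚ_[2]) : ℚ_[2] :=
  open Classical in if ‖a‖ < ‖b‖ then b else 0

/-- The sum of two odd 2-adic integers is even. -/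
theorem padic_two_norm_add_lt_one {x y : ℚ_[2]} (hx : ‖x‖ = 1) (hy : ‖y‖ = 1) : ‖x + y‖ < 1 := by
  have key : ∀ z : ℤ_[2], ‖z‖ = 1 → PadicInt.toZMod z = 1 := by
    intro z hz
    have hne : PadicInt.toZMod z ≠ 0 := by
      intro h0
      have : z ∈ RingHom.ker (PadicInt.toZMod (p := 2)) := h0
      rw [PadicInt.ker_toZMod, IsLocalRing.mem_maximalIdeal, PadicInt.mem_nonunits] at this
      exact this.ne hz
    revert hne
    generalize PadicInt.toZMod z = c
    revert c; decide
  let X : ℤ_[2] := ⟨x, hx.le⟩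
  let Y : ℤ_[2] := ⟨y, hy.le⟩
  have hXY : PadicInt.toZMod (X + Y) = 0 := by
    rw [map_add, key X hx, key Y hy]; decide
  have : X + Y ∈ RingHom.ker (PadicInt.toZMod (p := 2)) := hXY
  rw [PadicInt.ker_toZMod, IsLocalRing.mem_maximalIdeal, PadicInt.mem_nonunits] at this
  exact this

/-- A finite sum of 2-adic integers that vanishes has an even number of unit terms. -/
theorem even_card_of_sum_eq_zero {ι : Type*} [Fintype ι] (f : ι → ℚ_[2]) (hf : ∀ i, ‖f i‖ ≤ 1)
    (h0 : ∑ i, f i = 0) (s : Finset ι) (hs : ∀ i, i ∈ s ↔ ‖f i‖ = 1) : Even s.card := by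
  have key : ∀ z : ℤ_[2], PadicInt.toZMod z = if ‖z‖ = 1 then 1 else 0 := by
    intro z
    have h : PadicInt.toZMod z = 0 ↔ ‖z‖ < 1 := by
      have : PadicInt.toZMod z = 0 ↔ z ∈ RingHom.ker (PadicInt.toZMod (p := 2)) := Iff.rfl
      rw [this, PadicInt.ker_toZMod, IsLocalRing.mem_maximalIdeal, PadicInt.mem_nonunits]
    split_ifs with h1
    · have hne : PadicInt.toZMod z ≠ 0 := fun h2 => (h.1 h2).ne h1
      revert hne
      generalize PadicInt.toZMod z = c
      revert c; decide
    · exact h.2 (lt_of_le_of_ne z.norm_le_one h1)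
  let F : ι → ℤ_[2] := fun i => ⟨f i, hf i⟩
  have hF : ∑ i, F i = 0 := by
    apply Subtype.ext
    rw [PadicInt.coe_sum]
    exact h0
  have h := congrArg PadicInt.toZMod hF
  rw [map_sum, map_zero, Finset.sum_congr rfl fun i _ => key (F i), Finset.sum_boole] at h
  rw [← ZMod.natCast_eq_zero_iff_even, ← h]
  congr 2
  ext i
  simp only [hs, Finset.mem_filter, Finset.mem_univ, true_and]
  rfl

section
variable {a₁ b₁ a₂ b₂ a₃ b₃ : ℚ_[2]}

theorem norm_le_of_add_eq_zero {x y z : ℚ_[2]} (h : x + y + z = 0) : ‖z‖ ≤ max ‖x‖ ‖y‖ := by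
  have : z = -(x + y) := by linear_combination h
  rw [this, norm_neg]
  exact IsUltrametricDist.norm_add_le_max x y

theorem norm_eq_of_add_eq_zero {x y z : ℚ_[2]} (h : x + y + z = 0) (hlt : ‖z‖ < max ‖x‖ ‖y‖) :
    ‖x‖ = ‖y‖ := by
  by_contra hne
  have : z = -(x + y) := by linear_combination h
  rw [this, norm_neg, IsUltrametricDist.norm_add_eq_max_of_norm_ne_norm hne] at hlt
  exact hlt.false

/-- The norm of a unimodular determinant, when one of its two terms dominates. -/
theorem norm_mul_eq_one_of_lt (h : a₁ * b₂ - b₁ * a₂ = 1) (hlt : ‖a₁ * b₂‖ < ‖b₁ * a₂‖) :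
    ‖b₁‖ * ‖a₂‖ = 1 := by
  have h1 := IsUltrametricDist.norm_add_eq_max_of_norm_ne_norm
    (show ‖a₁ * b₂‖ ≠ ‖-(b₁ * a₂)‖ by rw [norm_neg]; exact hlt.ne)
  rw [← sub_eq_add_neg, h, norm_neg, max_eq_right hlt.le, norm_one, norm_mul] at h1
  exact h1.symm

theorem det_ne_one_of_norm_mul_lt (h : ‖a₁‖ * ‖b₂‖ < 1) (h' : ‖b₁‖ * ‖a₂‖ < 1) :
    a₁ * b₂ - b₁ * a₂ ≠ 1 := by
  intro hd
  have := IsUltrametricDist.norm_add_le_max (a₁ * b₂) (-(b₁ * a₂))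
  rw [← sub_eq_add_neg, hd, norm_one, norm_neg, norm_mul, norm_mul] at this
  exact (max_lt h h').not_ge this

/-- Integrality of the vectors `(a₁, b₁)` and `(a₂, b₂)`. If three vectors add up to zero and two of
them are integral, then so is the third one. -/
def Integral₂ (a₁ b₁ a₂ b₂ : ℚ_[2]) : Prop := ‖a₁‖ ≤ 1 ∧ ‖b₁‖ ≤ 1 ∧ ‖a₂‖ ≤ 1 ∧ ‖b₂‖ ≤ 1

theorem Integral₂.rotate (h : Integral₂ a₁ b₁ a₂ b₂) (ha : a₁ + a₂ + a₃ = 0)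
    (hb : b₁ + b₂ + b₃ = 0) : Integral₂ a₂ b₂ a₃ b₃ :=
  ⟨h.2.2.1, h.2.2.2, (norm_le_of_add_eq_zero ha).trans (max_le h.1 h.2.2.1),
    (norm_le_of_add_eq_zero hb).trans (max_le h.2.1 h.2.2.2)⟩

/-- Exactly one of the three vectors is steep: their steep parts add up to `b₁`, and
`‖b₁‖ * ‖a₂‖ = 1` with `‖b₁‖ ≤ ‖a₂‖`. -/
theorem steep_one (ha : a₁ + a₂ + a₃ = 0) (hd : a₁ * b₂ - b₁ * a₂ = 1)
    (h1 : ‖a₁‖ < ‖b₁‖) (h2 : ‖b₂‖ ≤ ‖a₂‖) (h3 : ‖b₃‖ ≤ ‖a₃‖) (hb : b₁ + b₂ + b₃ = 0) :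
    ‖b₁‖ ≤ 1 ∧ (‖b₁‖ = 1 ↔ Integral₂ a₁ b₁ a₂ b₂) := by
  have hb1 : ‖b₁‖ ≤ max ‖a₂‖ ‖a₃‖ := by
    refine (norm_le_of_add_eq_zero (x := b₂) (y := b₃) (by linear_combination hb)).trans ?_
    exact max_le_max h2 h3
  have he : ‖a₂‖ = ‖a₃‖ :=
    norm_eq_of_add_eq_zero (z := a₁) (by linear_combination ha) (h1.trans_le hb1)
  rw [← he, max_self] at hb1
  have hp1 : 0 < ‖b₁‖ := (norm_nonneg _).trans_lt h1
  have hp2 : 0 < ‖a₂‖ := hp1.trans_le hb1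
  have hm : ‖b₁‖ * ‖a₂‖ = 1 := by
    apply norm_mul_eq_one_of_lt hd
    rw [norm_mul, norm_mul]
    calc ‖a₁‖ * ‖b₂‖ ≤ ‖a₁‖ * ‖a₂‖ := by gcongr
      _ < ‖b₁‖ * ‖a₂‖ := by gcongr
  have hle : ‖b₁‖ ≤ 1 := by nlinarith
  refine ⟨hle, fun h => ?_, fun h => ?_⟩
  · rw [h, one_mul] at hm
    exact ⟨h1.le.trans hle, hle, hm.le, h2.trans hm.le⟩
  · have := h.2.2.1
    nlinarith

/-- Exactly two of the three vectors are steep: their steep parts add up to `-b₃`, and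
`‖b₁‖ * ‖a₃‖ = 1` with `‖b₃‖ ≤ ‖a₃‖ < ‖b₁‖`. -/
theorem steep_two (ha : a₁ + a₂ + a₃ = 0) (hb : b₁ + b₂ + b₃ = 0)
    (hd : a₁ * b₃ - b₁ * a₃ = -1)
    (h1 : ‖a₁‖ < ‖b₁‖) (h2 : ‖a₂‖ < ‖b₂‖) (h3 : ‖b₃‖ ≤ ‖a₃‖) :
    ‖b₁ + b₂‖ < 1 ∧ ¬ Integral₂ a₁ b₁ a₂ b₂ := by
  have ha3 : ‖a₃‖ < max ‖b₁‖ ‖b₂‖ :=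
    (norm_le_of_add_eq_zero ha).trans_lt
      (max_lt (h1.trans_le (le_max_left _ _)) (h2.trans_le (le_max_right _ _)))
  have he : ‖b₁‖ = ‖b₂‖ := norm_eq_of_add_eq_zero hb (h3.trans_lt ha3)
  rw [← he, max_self] at ha3
  have hp1 : 0 < ‖b₁‖ := (norm_nonneg _).trans_lt h1
  have hp3 : 0 < ‖a₃‖ := by
    rw [norm_pos_iff]
    rintro rfl
    have : b₃ = 0 := by simpa using h3
    subst this
    simp at hd
  have hm : ‖b₁‖ * ‖-a₃‖ = 1 := by
    apply norm_mul_eq_one_of_lt (a₁ := a₁) (b₂ := -b₃) (by linear_combination -hd)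
    rw [norm_mul, norm_mul, norm_neg, norm_neg]
    calc ‖a₁‖ * ‖b₃‖ ≤ ‖a₁‖ * ‖a₃‖ := by gcongr
      _ < ‖b₁‖ * ‖a₃‖ := by gcongr
  rw [norm_neg] at hm
  have hs : b₁ + b₂ = -b₃ := by linear_combination hb
  refine ⟨?_, fun h => ?_⟩
  · rw [hs, norm_neg]
    refine h3.trans_lt ?_
    nlinarith
  · have := h.2.1
    nlinarith

theorem not_integral_of_all_steep (hd : a₁ * b₂ - b₁ * a₂ = 1)
    (h1 : ‖a₁‖ < ‖b₁‖) (h2 : ‖a₂‖ < ‖b₂‖) : ¬ Integral₂ a₁ b₁ a₂ b₂ := by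
  rintro ⟨i1, i2, i3, i4⟩
  refine det_ne_one_of_norm_mul_lt ?_ ?_ hd
  · have := norm_nonneg b₂; have := norm_nonneg a₁; nlinarith
  · have := norm_nonneg b₁; have := norm_nonneg a₂; nlinarith

theorem not_integral_of_none_steep (ha : a₁ + a₂ + a₃ = 0) (hb : b₁ + b₂ + b₃ = 0)
    (hd : a₁ * b₂ - b₁ * a₂ = 1)
    (h1 : ‖b₁‖ ≤ ‖a₁‖) (h2 : ‖b₂‖ ≤ ‖a₂‖) (h3 : ‖b₃‖ ≤ ‖a₃‖) : ¬ Integral₂ a₁ b₁ a₂ b₂ := by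
  intro hi
  have hi3 := hi.rotate ha hb
  obtain ⟨i1, i2, i3, i4⟩ := hi
  have n1 := norm_nonneg a₁
  have n2 := norm_nonneg a₂
  -- An even first coordinate of a vector that is not steep makes the whole vector even, which a
  -- unimodular determinant excludes. But three 2-adic integers with sum zero are not all odd.
  have aux : ∀ {x y z w : ℚ_[2]}, ‖y‖ ≤ ‖x‖ → ‖w‖ ≤ ‖z‖ → ‖z‖ ≤ 1 → ‖x‖ < 1 →
      x * w - y * z ≠ 1 := by
    intro x y z w hyx hwz hz hx
    have := norm_nonneg x
    have := norm_nonneg y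
    have := norm_nonneg w
    exact det_ne_one_of_norm_mul_lt (by nlinarith) (by nlinarith)
  rcases i1.lt_or_eq with l1 | e1
  · exact aux h1 h2 i3 l1 hd
  rcases i3.lt_or_eq with l2 | e2
  · exact aux (x := a₂) (y := -b₂) (z := a₁) (w := -b₁) (by simpa using h2) (by simpa using h1)
      i1 l2 (by linear_combination hd)
  · have l3 : ‖a₃‖ < 1 := by
      have : a₃ = -(a₁ + a₂) := by linear_combination ha
      rw [this, norm_neg]
      exact padic_two_norm_add_lt_one e1 e2
    refine aux h3 h1 i1 l3 ?_
    have e3 : a₃ = -a₁ - a₂ := by linear_combination ha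
    have e4 : b₃ = -b₁ - b₂ := by linear_combination hb
    rw [e3, e4]
    linear_combination hd

/-- For three vectors of `ℚ_[2]²` with sum zero that span a triangle of determinant one, the sum
of their steep parts is a 2-adic integer, and it is a unit exactly if the vectors are
integral. -/
theorem norm_sum_steepPart (ha : a₁ + a₂ + a₃ = 0) (hb : b₁ + b₂ + b₃ = 0)
    (hd : a₁ * b₂ - b₁ * a₂ = 1) :
    ‖steepPart a₁ b₁ + steepPart a₂ b₂ + steepPart a₃ b₃‖ ≤ 1 ∧
      (‖steepPart a₁ b₁ + steepPart a₂ b₂ + steepPart a₃ b₃‖ = 1 ↔ Integral₂ a₁ b₁ a₂ b₂) := by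
  have e3 : a₃ = -a₁ - a₂ := by linear_combination ha
  have e4 : b₃ = -b₁ - b₂ := by linear_combination hb
  have ha2 : a₂ + a₃ + a₁ = 0 := by linear_combination ha
  have hb2 : b₂ + b₃ + b₁ = 0 := by linear_combination hb
  have ha3 : a₃ + a₁ + a₂ = 0 := by linear_combination ha
  have hb3 : b₃ + b₁ + b₂ = 0 := by linear_combination hb
  have hd2 : a₂ * b₃ - b₂ * a₃ = 1 := by rw [e3, e4]; linear_combination hd
  have hd3 : a₃ * b₁ - b₃ * a₁ = 1 := by rw [e3, e4]; linear_combination hd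
  have r12 : Integral₂ a₁ b₁ a₂ b₂ ↔ Integral₂ a₂ b₂ a₃ b₃ :=
    ⟨fun h => h.rotate ha hb, fun h => (h.rotate ha2 hb2).rotate ha3 hb3⟩
  have r13 : Integral₂ a₁ b₁ a₂ b₂ ↔ Integral₂ a₃ b₃ a₁ b₁ :=
    ⟨fun h => (h.rotate ha hb).rotate ha2 hb2, fun h => h.rotate ha3 hb3⟩
  unfold steepPart
  by_cases h1 : ‖a₁‖ < ‖b₁‖ <;> by_cases h2 : ‖a₂‖ < ‖b₂‖ <;> by_cases h3 : ‖a₃‖ < ‖b₃‖ <;>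
    simp only [h1, h2, h3, if_true, if_false, add_zero, zero_add, hb, norm_zero]
  · exact ⟨zero_le_one, by simp, fun h => absurd h (not_integral_of_all_steep hd h1 h2)⟩
  · obtain ⟨hl, hn⟩ := steep_two ha hb (by linear_combination -hd3) h1 h2 (not_lt.1 h3)
    exact ⟨hl.le, fun h => absurd h hl.ne, fun h => absurd h hn⟩
  · obtain ⟨hl, hn⟩ := steep_two ha3 hb3 (by linear_combination -hd2) h3 h1 (not_lt.1 h2)
    rw [r13, add_comm b₁]
    exact ⟨hl.le, fun h => absurd h hl.ne, fun h => absurd h hn⟩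
  · exact steep_one ha hd h1 (not_lt.1 h2) (not_lt.1 h3) hb
  · obtain ⟨hl, hn⟩ := steep_two ha2 hb2 (by linear_combination -hd) h2 h3 (not_lt.1 h1)
    rw [r12]
    exact ⟨hl.le, fun h => absurd h hl.ne, fun h => absurd h hn⟩
  · rw [r12]
    exact steep_one ha2 hd2 h2 (not_lt.1 h3) (not_lt.1 h1) hb2
  · rw [r13]
    exact steep_one ha3 hd3 h3 (not_lt.1 h1) (not_lt.1 h2) hb3
  · exact ⟨zero_le_one, by simp, fun h => absurd h (not_integral_of_none_steep ha hb hd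
      (not_lt.1 h1) (not_lt.1 h2) (not_lt.1 h3))⟩

end

/-! ### A line-additive function that detects a lattice -/

/-- The point of the plane with given rational coordinates. -/
noncomputable def ratPoint (z : ℚ × ℚ) : Plane := !₂[(z.1 : ℝ), (z.2 : ℝ)]

theorem planeDet_ratPoint (z w : ℚ × ℚ) : planeDet (ratPoint z) (ratPoint w) = cross z w := by
  simp [planeDet, ratPoint, cross]

/-- A `ℚ`-linear retraction of `ℝ` onto `ℚ`, with values read in `ℚ_[2]`. -/
theorem exists_retraction : ∃ φ : ℝ →ₗ[ℚ] ℚ_[2], ∀ q : ℚ, φ q = q := by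
  obtain ⟨f, hf⟩ := LinearMap.exists_leftInverse_of_injective (Algebra.linearMap ℚ ℝ)
    (LinearMap.ker_eq_bot.2 (algebraMap ℚ ℝ).injective)
  refine ⟨Algebra.linearMap ℚ ℚ_[2] ∘ₗ f, fun q => ?_⟩
  have : f (q : ℝ) = q := LinearMap.congr_fun hf q
  simp [this]

/-- The steep part of a vector of the real plane with respect to the rational basis `u`, `w`: on
the rational lines that are 2-adically steep it is the second coordinate, made 2-adic by `φ`, and
it vanishes on all other lines. -/
noncomputable def planeSteepPart (φ : ℝ →ₗ[ℚ] ℚ_[2]) (u w : ℚ × ℚ) (z : Plane) : ℚ_[2] :=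
  open Classical in
  if ∃ r : ℚ, ‖(r : ℚ_[2])‖ < 1 ∧ planeDet z (ratPoint w) = r * planeDet (ratPoint u) z then
    φ (planeDet (ratPoint u) z / (cross u w : ℚ)) else 0

theorem planeDet_smul_left (t : ℝ) (v w : Plane) : planeDet (t • v) w = t * planeDet v w := by
  simp [planeDet]; ring

theorem planeDet_smul_right (t : ℝ) (v w : Plane) : planeDet v (t • w) = t * planeDet v w := by
  simp [planeDet]; ring

theorem planeSteepPart_add_smul (φ : ℝ →ₗ[ℚ] ℚ_[2]) (u w : ℚ × ℚ) (v : Plane) (t s : ℝ) :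
    planeSteepPart φ u w ((t + s) • v) =
      planeSteepPart φ u w (t • v) + planeSteepPart φ u w (s • v) := by
  by_cases h : ∃ r : ℚ, ‖(r : ℚ_[2])‖ < 1 ∧
      planeDet v (ratPoint w) = r * planeDet (ratPoint u) v
  · have key : ∀ t : ℝ, planeSteepPart φ u w (t • v) =
        φ (t * planeDet (ratPoint u) v / (cross u w : ℚ)) := by
      intro t
      obtain ⟨r, hr, he⟩ := h
      have he' : planeDet (t • v) (ratPoint w) = r * planeDet (ratPoint u) (t • v) := by
        rw [planeDet_smul_right, planeDet_smul_left, he, mul_left_comm]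
      rw [planeSteepPart, if_pos ⟨r, hr, he'⟩, planeDet_smul_right]
    rw [key, key, key, add_mul, add_div, map_add]
  · have key : ∀ t : ℝ, planeSteepPart φ u w (t • v) = 0 := by
      intro t
      rcases eq_or_ne t 0 with rfl | ht
      · have h0 : planeDet (ratPoint u) ((0 : ℝ) • v) = 0 := by rw [planeDet_smul_right, zero_mul]
        rw [planeSteepPart, h0, zero_div, map_zero, ite_self]
      · refine if_neg fun ⟨r, hr, he⟩ => h ⟨r, hr, ?_⟩
        rw [planeDet_smul_right, planeDet_smul_left, mul_left_comm] at he
        exact mul_left_cancel₀ ht he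
    rw [key, key, key, add_zero]

theorem planeSteepPart_ratPoint {φ : ℝ →ₗ[ℚ] ℚ_[2]} (hφ : ∀ q : ℚ, φ q = q) {u w : ℚ × ℚ}
    (hd : cross u w ≠ 0) (z : ℚ × ℚ) :
    planeSteepPart φ u w (ratPoint z) =
      steepPart ((cross z w / cross u w : ℚ) : ℚ_[2]) ((cross u z / cross u w : ℚ) : ℚ_[2]) := by
  rw [planeSteepPart, steepPart, planeDet_ratPoint, planeDet_ratPoint, ← Rat.cast_div, hφ]
  rcases eq_or_ne (cross u z) 0 with h0 | h0
  · simp [h0]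
  · congr 1
    have h0' : cross u z / cross u w ≠ 0 := div_ne_zero h0 hd
    have hpos : 0 < ‖((cross u z / cross u w : ℚ) : ℚ_[2])‖ := by
      rw [norm_pos_iff]; exact_mod_cast h0'
    refine propext ⟨?_, fun h => ⟨cross z w / cross u z, ?_, ?_⟩⟩
    · rintro ⟨r, hr, he⟩
      have he : cross z w = r * cross u z := by exact_mod_cast he
      rw [he, mul_div_assoc, Rat.cast_mul, norm_mul]
      nlinarith
    · have : cross z w / cross u z = (cross z w / cross u w) / (cross u z / cross u w) := by
        field_simp
      rw [this, Rat.cast_div, norm_div, div_lt_one hpos]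
      exact h
    · rw [← Rat.cast_mul, div_mul_cancel₀ _ h0]

/-- The rational points with 2-adically integral coordinates with respect to the basis
`u`, `w`. -/
def dyadicLattice (u w : ℚ × ℚ) : Set (ℚ × ℚ) :=
  {z | ‖((cross z w / cross u w : ℚ) : ℚ_[2])‖ ≤ 1 ∧ ‖((cross u z / cross u w : ℚ) : ℚ_[2])‖ ≤ 1}

/-- Two bases of equal determinant span the same lattice as soon as the first one lies in the
lattice of the second one. -/
theorem dyadicLattice_eq_iff {u w u' w' : ℚ × ℚ} (hd : cross u w ≠ 0)
    (h : cross u' w' = cross u w) :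
    dyadicLattice u' w' = dyadicLattice u w ↔ u' ∈ dyadicLattice u w ∧ w' ∈ dyadicLattice u w := by
  have hmul : ∀ {a b c e : ℚ_[2]}, ‖a‖ ≤ 1 → ‖b‖ ≤ 1 → ‖c‖ ≤ 1 → ‖e‖ ≤ 1 →
      ‖a * b + c * e‖ ≤ 1 := by
    intro a b c e ha hb hc he
    refine (IsUltrametricDist.norm_add_le_max _ _).trans (max_le ?_ ?_) <;> rw [norm_mul]
    · exact mul_le_one₀ ha (norm_nonneg _) hb
    · exact mul_le_one₀ hc (norm_nonneg _) he
  constructor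
  · intro he
    rw [← he]
    have h1 : cross u' u' = 0 := by simp only [cross]; ring
    have h2 : cross w' w' = 0 := by simp only [cross]; ring
    have hd' : cross u' w' ≠ 0 := h ▸ hd
    exact ⟨⟨by rw [div_self hd']; simp, by rw [h1]; simp⟩,
      ⟨by rw [h2]; simp, by rw [div_self hd']; simp⟩⟩
  · rintro ⟨⟨h1, h2⟩, h3, h4⟩
    ext z
    constructor
    · rintro ⟨h5, h6⟩
      rw [h] at h5 h6
      constructor
      · have e : cross z w / cross u w = (cross z w' / cross u w) * (cross u' w / cross u w) +
            (cross u' z / cross u w) * (cross w' w / cross u w) := by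
          field_simp
          rw [← h]; simp only [cross]; ring
        rw [e]; push_cast at h1 h2 h3 h4 h5 h6 ⊢
        exact hmul h5 h1 h6 h3
      · have e : cross u z / cross u w = (cross z w' / cross u w) * (cross u u' / cross u w) +
            (cross u' z / cross u w) * (cross u w' / cross u w) := by
          field_simp
          rw [← h]; simp only [cross]; ring
        rw [e]; push_cast at h1 h2 h3 h4 h5 h6 ⊢
        exact hmul h5 h2 h6 h4
    · rintro ⟨h5, h6⟩
      constructor <;> rw [h]
      · have e : cross z w' / cross u w = (cross z w / cross u w) * (cross u w' / cross u w) +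
            (cross u z / cross u w) * (-(cross w' w / cross u w)) := by
          field_simp
          simp only [cross]; ring
        rw [e]; push_cast at h1 h2 h3 h4 h5 h6 ⊢
        exact hmul h5 h4 h6 (by rwa [norm_neg])
      · have e : cross u' z / cross u w = (cross z w / cross u w) * (-(cross u u' / cross u w)) +
            (cross u z / cross u w) * (cross u' w / cross u w) := by
          field_simp
          simp only [cross]; ring
        rw [e]; push_cast at h1 h2 h3 h4 h5 h6 ⊢
        exact hmul h5 (by rwa [norm_neg]) h6 h1

/-- If all line-additive functions vanish on a family of triangles of equal oriented area, given
by their rational side vectors, then the number of triangles is even: the triangles that span a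
given lattice are even in number. -/
theorem even_of_sum_eq_zero {m : ℕ} (E : Fin m → Fin 3 → ℚ × ℚ) {d : ℚ} (hd : d ≠ 0)
    (hE : ∀ j, E j 0 + E j 1 + E j 2 = 0) (hdet : ∀ j, cross (E j 0) (E j 1) = d)
    (h : ∀ G : Plane → ℚ_[2],
      (∀ v : Plane, ∀ t u : ℝ, G ((t + u) • v) = G (t • v) + G (u • v)) →
        ∑ j, ∑ k, G (ratPoint (E j k)) = 0) : Even m := by
  classical
  obtain ⟨φ, hφ⟩ := exists_retraction
  have hclass : ∀ j₀, Even (Finset.univ.filter fun j =>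
      dyadicLattice (E j 0) (E j 1) = dyadicLattice (E j₀ 0) (E j₀ 1)).card := by
    intro j₀
    set u := E j₀ 0
    set w := E j₀ 1
    have huw : cross u w = d := hdet j₀
    have hd0 : cross u w ≠ 0 := huw ▸ hd
    have key : ∀ j, ‖∑ k, planeSteepPart φ u w (ratPoint (E j k))‖ ≤ 1 ∧
        (‖∑ k, planeSteepPart φ u w (ratPoint (E j k))‖ = 1 ↔
          dyadicLattice (E j 0) (E j 1) = dyadicLattice u w) := by
      intro j
      have h1 := congrArg Prod.fst (hE j)
      have h2 := congrArg Prod.snd (hE j)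
      simp only [Prod.fst_add, Prod.snd_add, Prod.fst_zero, Prod.snd_zero] at h1 h2
      have hj := hdet j
      rw [dyadicLattice_eq_iff hd0 (hj.trans huw.symm), Fin.sum_univ_three]
      simp only [planeSteepPart_ratPoint hφ hd0]
      have main := norm_sum_steepPart
        (a₁ := ((cross (E j 0) w / cross u w : ℚ) : ℚ_[2]))
        (b₁ := ((cross u (E j 0) / cross u w : ℚ) : ℚ_[2]))
        (a₂ := ((cross (E j 1) w / cross u w : ℚ) : ℚ_[2]))
        (b₂ := ((cross u (E j 1) / cross u w : ℚ) : ℚ_[2]))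
        (a₃ := ((cross (E j 2) w / cross u w : ℚ) : ℚ_[2]))
        (b₃ := ((cross u (E j 2) / cross u w : ℚ) : ℚ_[2])) ?_ ?_ ?_
      · refine ⟨main.1, main.2.trans ?_⟩
        simp only [Integral₂, dyadicLattice, Set.mem_ofPred_eq, and_assoc]
      · norm_cast
        rw [← add_div, ← add_div, div_eq_zero_iff]
        left
        simp only [cross]
        linear_combination w.2 * h1 - w.1 * h2
      · norm_cast
        rw [← add_div, ← add_div, div_eq_zero_iff]
        left
        simp only [cross]
        linear_combination u.1 * h2 - u.2 * h1
      · norm_cast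
        have : cross (E j 0) (E j 1) = cross u w := hj.trans huw.symm
        field_simp
        rw [sq, ← this]
        nth_rewrite 1 [this]
        simp only [cross]; ring
    refine even_card_of_sum_eq_zero _ (fun j => (key j).1)
      (h _ fun v t s => planeSteepPart_add_smul φ u w v t s) _ fun j => ?_
    rw [Finset.mem_filter, (key j).2]
    simp
  have hcard := Finset.card_eq_sum_card_image
    (fun j => dyadicLattice (E j 0) (E j 1)) (Finset.univ : Finset (Fin m))
  rw [Finset.card_univ, Fintype.card_fin] at hcard
  rw [hcard]
  refine Finset.even_sum _ fun L hL => ?_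
  obtain ⟨j₀, _, rfl⟩ := Finset.mem_image.1 hL
  exact hclass j₀

/-! ### Areas of triangles -/

/-- The area of a triangle is proportional to the absolute value of its determinant. -/
theorem volume_triangle : ∃ c : ENNReal, c ≠ 0 ∧ c ≠ ⊤ ∧ ∀ p : Fin 3 → Plane,
    volume (convexHull ℝ (Set.range p)) =
      ENNReal.ofReal |planeDet (p 1 - p 0) (p 2 - p 0)| * c := by
  -- The reference triangle is listed clockwise, as `mem_interior_triangle` requires.
  let e : Fin 3 → Plane := ![0, !₂[0, 1], !₂[1, 0]]
  refine ⟨volume (convexHull ℝ (Set.range e)), ?_, ?_, fun p => ?_⟩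
  · have he : planeDet (e 1 - e 0) (e 2 - e 0) < 0 := by simp [e, planeDet]
    have hmem : !₂[(1 / 4 : ℝ), 1 / 4] ∈ interior (convexHull ℝ (Set.range e)) := by
      refine mem_interior_triangle he fun k => ?_
      have e0 : e 0 = 0 := rfl
      have e1 : e 1 = !₂[0, 1] := rfl
      have e2 : e 2 = !₂[1, 0] := rfl
      fin_cases k
      · change sideDet (e 0) (e 1) _ < 0
        norm_num [e0, e1, sideDet, planeDet]
      · change sideDet (e 1) (e 2) _ < 0
        norm_num [e1, e2, sideDet, planeDet]
      · change sideDet (e 2) (e 0) _ < 0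
        norm_num [e2, e0, sideDet, planeDet]
    exact ((isOpen_interior.measure_pos volume ⟨_, hmem⟩).trans_le
      (measure_mono interior_subset)).ne'
  · exact ((isBounded_convexHull.2 (Set.finite_range e).isBounded).measure_lt_top).ne
  · let A : Plane →ₗ[ℝ] Plane := Matrix.toEuclideanLin
      !![(p 2 - p 0) 0, (p 1 - p 0) 0; (p 2 - p 0) 1, (p 1 - p 0) 1]
    have hdet : LinearMap.det A = -planeDet (p 1 - p 0) (p 2 - p 0) := by
      have : LinearMap.det A = Matrix.det
          !![(p 2 - p 0) 0, (p 1 - p 0) 0; (p 2 - p 0) 1, (p 1 - p 0) 1] :=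
        LinearMap.det_toLpLin 2 _
      rw [this, Matrix.det_fin_two_of, planeDet]; ring
    have himg : convexHull ℝ (Set.range p) =
        (fun x => x + p 0) '' (A '' convexHull ℝ (Set.range e)) := by
      have h1 : A '' convexHull ℝ (Set.range e) = convexHull ℝ (Set.range (A ∘ e)) := by
        rw [A.image_convexHull, Set.range_comp]
      have h2 : (fun x => x + p 0) = (AffineEquiv.vaddConst ℝ (p 0) : Plane →ᵃ[ℝ] Plane) := by
        ext x; simp
      have h3 : ∀ k, A (e k) + p 0 = p k := by
        intro k
        fin_cases k
        · simp [e]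
        · apply plane_ext <;> simp [e, A]
        · apply plane_ext <;> simp [e, A]
      rw [h1, h2, AffineMap.image_convexHull, ← h2, ← Set.range_comp]
      exact congrArg _ (congrArg _ (funext fun k => (h3 k).symm))
    rw [himg, Set.image_add_right, measure_preimage_add_right, Measure.addHaar_image_linearMap,
      hdet, abs_neg]

/-- The vertices of a triangle can be listed in clockwise order. -/
theorem exists_clockwise (T : Affine.Triangle ℝ Plane) : ∃ σ : Equiv.Perm (Fin 3),
    planeDet (T.points (σ 1) - T.points (σ 0)) (T.points (σ 2) - T.points (σ 0)) < 0 := by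
  have hne : planeDet (T.points 1 - T.points 0) (T.points 2 - T.points 0) ≠ 0 := by
    intro h0
    have hv : T.points 1 - T.points 0 ≠ 0 := sub_ne_zero.2
      (T.independent.injective.ne (by decide))
    obtain ⟨a, ha⟩ := exists_eq_smul_of_planeDet_eq_zero hv h0
    refine (affineIndependent_iff_not_collinear.1 T.independent) ?_
    rw [collinear_iff_of_mem (p₀ := T.points 0) (Set.mem_range_self 0)]
    refine ⟨T.points 1 - T.points 0, ?_⟩
    rintro _ ⟨k, rfl⟩
    fin_cases k
    · exact ⟨0, by simp⟩
    · exact ⟨1, by simp⟩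
    · exact ⟨a, by simp [← ha]⟩
  rcases lt_or_gt_of_ne hne with h | h
  · exact ⟨1, h⟩
  · refine ⟨Equiv.swap 1 2, ?_⟩
    have e0 : Equiv.swap (1 : Fin 3) 2 0 = 0 := by decide
    rw [e0, Equiv.swap_apply_left, Equiv.swap_apply_right]
    simp only [planeDet] at h ⊢
    linarith

/-! ### Equidissections of balanced polygons -/

theorem theorem2 (P : PlanePolygon) (hP : P.IsBalanced) :
    ¬ ∃ (m : ℕ) (T : Fin m → Affine.Triangle ℝ Plane),
      Odd m ∧ IsCutInto P T ∧
      (∀ i j, volume (solidTriangle (T i)) = volume (solidTriangle (T j))) ∧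
      (∀ (i : Fin m) (k : Fin 3) (c : Fin 2), ∃ q : ℚ, (T i).points k c = (q : ℝ)) := by
  rintro ⟨m, T, hm, ⟨hU, hI⟩, hvol, hrat⟩
  choose σ hσ using fun j => exists_clockwise (T j)
  choose r hr using hrat
  have hrange : ∀ j, solidTriangle (T j) =
      convexHull ℝ (Set.range fun k => (T j).points (σ j k)) := fun j => by
    rw [solidTriangle]
    exact congrArg _ (EquivLike.range_comp (T j).points (σ j)).symm
  simp only [hrange] at hU hI hvol
  set p : Fin m → Fin 3 → Plane := fun j k => (T j).points (σ j k)
  let E : Fin m → Fin 3 → ℚ × ℚ := fun j k =>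
    (r j (σ j (k + 1)) 0 - r j (σ j k) 0, r j (σ j (k + 1)) 1 - r j (σ j k) 1)
  have hEp : ∀ j k, p j (k + 1) - p j k = ratPoint (E j k) := fun j k => by
    apply plane_ext <;> simp [p, E, ratPoint, hr]
  have hdet : ∀ j, (cross (E j 0) (E j 1) : ℝ) = planeDet (p j 1 - p j 0) (p j 2 - p j 0) := by
    intro j
    rw [← planeDet_ratPoint, ← hEp, ← hEp, ← planeDet_eq_sideDet (p j) 0]
    simp [sideDet, planeDet]
    ring
  refine Nat.not_even_iff_odd.2 hm ?_
  -- By oddness there is a triangle; its determinant serves as the common one.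
  let j₀ : Fin m := ⟨0, hm.pos⟩
  obtain ⟨c, hc0, hctop, hc⟩ := volume_triangle
  refine even_of_sum_eq_zero E (d := cross (E j₀ 0) (E j₀ 1)) ?_ ?_ ?_ ?_
  · rw [← Rat.cast_ne_zero (α := ℝ), hdet]
    exact (hσ j₀).ne
  · intro j
    simp [E]
  · intro j
    have h := hvol j j₀
    rw [hc, hc, ENNReal.mul_left_inj hc0 hctop,
      ENNReal.ofReal_eq_ofReal_iff (abs_nonneg _) (abs_nonneg _),
      abs_of_neg (hσ j), abs_of_neg (hσ j₀), neg_inj, ← hdet, ← hdet] at h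
    exact_mod_cast h
  · intro G hG
    simp only [← hEp]
    rw [sum_sides_eq_sum_edges P hσ hU hI G hG]
    obtain ⟨τ, hτ, hne, hneg⟩ := hP
    refine Finset.sum_involution (fun i _ => τ i) (fun i _ => ?_) (fun i _ _ => hne i)
      (fun _ _ => Finset.mem_univ _) fun i _ => hτ i
    have h1 := hG (P.edge i) 1 (-1)
    have h2 := hG 0 0 0
    simp only [add_neg_cancel, zero_smul, one_smul, neg_smul, smul_zero, add_zero] at h1 h2
    rw [hneg, ← h1]
    simpa using h2
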